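/- **Setting.** Let $\Omega\subset\mathbb R^d$ be a bounded open set, let $y\in C^1(\overline\Omega;\mathbb R^m)$, and write $G(x)=\nabla y(x)$ for $x\in\overline\Omega$ (extended continuously to $\partial\Omega$). Equip $\mathbb R^{m\times d}$ with the Frobenius inner product $(A,B)=\mathrm{Tr}(AB^T)$ and norm $|\cdot|$. Let $W:\overline\Omega\times\mathbb R^{m\times d}\to\mathbb R$ be continuous, and suppose that there is an open set $\mathcal O\supset G(\overline\Omega)$ such that $W_F$ and $W_{FF}$ exist and are continuous on $\overline\Omega\times\mathcal O$. Put $$W^\circ(x,F)=W(x,G(x)+F)-W(x,G(x))-(W_F(x,G(x)),F),\qquad \mathsf L(x)=W_{FF}(x,G(x)),$$ $$U(x,F)=\frac{1}{|F|^2}\Big(W^\circ(x,F)-\tfrac12(\mathsf L(x)F,F)\Big)\ (F\ne0),\qquad U(x,0)=0,$$ $$\mathcal F(x,\alpha,F)=\frac{W^\circ(x,\alpha F)}{\alpha^2}=U(x,\alpha F)|F|^2+\tfrac12(\mathsf L(x)F,F)\qquad(\alpha>0).$$ Let $\alpha_n>0$ and let $\psi_n\in W^{1,\infty}(\Omega;\mathbb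 R^m)$ be bounded in $W^{1,2}(\Omega;\mathbb R^m)$ with $\alpha_n\nabla\psi_n$ bounded in $L^\infty(\Omega;\mathbb R^{m\times d})$. Let $\psi_n=z_n+v_n$ with $z_n,v_n\in W^{1,\infty}(\Omega;\mathbb R^m)$ such that $\int_\Omega v_n\,dx=0$; the sequence $|\nabla z_n|^2$ is equiintegrable; $v_n\rightharpoonup0$ weakly in $W^{1,2}(\Omega;\mathbb R^m)$; there are measurable sets $R_n\subset\Omega$ with $|R_n|\to0$ and $z_n=\psi_n$, $\nabla z_n=\nabla\psi_n$ a.e. on $\Omega\setminus R_n$; and $\alpha_n\nabla z_n$, $\alpha_n\nabla v_n$ are bounded in $L^\infty(\Omega;\mathbb R^{m\times d})$. Let $\nu=\{\nu_x\}_{x\in\Omega}$ be the Young measure generated by $\{\nabla\psi_n\}$, that is, a measurable family of probability measures on $\mathbb R^{m\times d}$ with $h(\nabla\psi_n)\rightharpoonup\int h\,d\nu_x$ weakly-* in $L^\infty(\Omega)$ for every $h\in C_0(\mathbb R^{m\times d})$, and put $$m(x)=\int_{\mathbb R^{m\times d}}|F|^2\,d\nu_x(F).$$ **Lemma.** Assume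 that $\alpha_n\to0$. Then $m(x)<\infty$ for a.e. $x\in\Omega$, and there is a subsequence (not relabeled) such that $$\mathcal F(x,\alpha_n,\nabla z_n)\rightharpoonup U(x,0)\,m(x)+\frac12\int_{\mathbb R^{m\times d}}(\mathsf L(x)F,F)\,d\nu_x(F)\qquad\text{weakly in }L^1(\Omega).$$ -/

import Mathlib

open MeasureTheory Filter Topology
open scoped ContDiff ENNReal NNReal ZeroAtInfty

namespace VarLimit

/-- `ℝ^{m×d}` with the Frobenius norm `|A|` and the Frobenius inner product
`(A, B) = Tr (A Bᵀ)`; the `(i, j)` entry of `A` is `A (i, j)`. -/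
abbrev Mat (m d : ℕ) : Type := EuclideanSpace ℝ (Fin m × Fin d)

/-- The Jacobian matrix `(∂_j y_i)` of a linear map `ℝ^d → ℝ^m`. -/
noncomputable def jacobian {d m : ℕ}
    (T : EuclideanSpace ℝ (Fin d) →L[ℝ] EuclideanSpace ℝ (Fin m)) : Mat m d :=
  WithLp.toLp 2 (fun p : Fin m × Fin d => T (EuclideanSpace.single p.2 1) p.1)

/-- `y ∈ C¹(Ω̄; ℝ^m)`, and `G` is the continuous extension of `∇y` to `Ω̄`. -/
structure IsC1Closure {d m : ℕ} (Ω : Set (EuclideanSpace ℝ (Fin d)))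
    (y : EuclideanSpace ℝ (Fin d) → EuclideanSpace ℝ (Fin m))
    (G : EuclideanSpace ℝ (Fin d) → Mat m d) : Prop where
  continuousOn : ContinuousOn y (closure Ω)
  contDiffOn : ContDiffOn ℝ 1 y Ω
  grad_eq : ∀ x ∈ Ω, G x = jacobian (fderiv ℝ y x)
  continuousOn_grad : ContinuousOn G (closure Ω)

/-- `W_F(x, A)`, as a matrix. -/
noncomputable def gradF {d m : ℕ} (W : EuclideanSpace ℝ (Fin d) → Mat m d → ℝ)
    (x : EuclideanSpace ℝ (Fin d)) (A : Mat m d) : Mat m d :=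
  gradient (W x) A

/-- `W_FF(x, A)`, as a linear map on matrices (a fourth order tensor). -/
noncomputable def hessF {d m : ℕ} (W : EuclideanSpace ℝ (Fin d) → Mat m d → ℝ)
    (x : EuclideanSpace ℝ (Fin d)) (A : Mat m d) : Mat m d →L[ℝ] Mat m d :=
  fderiv ℝ (gradF W x) A

/-- `W` is continuous on `Ω̄ × ℝ^{m×d}`, and of class `C²` on the range of `G`: there is an open
set `O ⊇ G(Ω̄)` such that `W_F` and `W_FF` exist and are continuous on `Ω̄ × O`. -/
structure IsLagrangian {d m : ℕ} (Ω : Set (EuclideanSpace ℝ (Fin d)))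
    (W : EuclideanSpace ℝ (Fin d) → Mat m d → ℝ)
    (G : EuclideanSpace ℝ (Fin d) → Mat m d) : Prop where
  continuousOn : ContinuousOn (fun p : EuclideanSpace ℝ (Fin d) × Mat m d => W p.1 p.2)
    (closure Ω ×ˢ Set.univ)
  c2_on_range : ∃ O : Set (Mat m d), IsOpen O ∧ (∀ x ∈ closure Ω, G x ∈ O) ∧
    (∀ x ∈ closure Ω, DifferentiableOn ℝ (W x) O) ∧
    (∀ x ∈ closure Ω, DifferentiableOn ℝ (gradF W x) O) ∧
    ContinuousOn (fun p : EuclideanSpace ℝ (Fin d) × Mat m d => gradF W p.1 p.2)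
      (closure Ω ×ˢ O) ∧
    ContinuousOn (fun p : EuclideanSpace ℝ (Fin d) × Mat m d => hessF W p.1 p.2)
      (closure Ω ×ˢ O)

/-- `W°(x, A) = W(x, G(x) + A) - W(x, G(x)) - (W_F(x, G(x)), A)`. -/
noncomputable def Wcirc {d m : ℕ} (W : EuclideanSpace ℝ (Fin d) → Mat m d → ℝ)
    (G : EuclideanSpace ℝ (Fin d) → Mat m d)
    (x : EuclideanSpace ℝ (Fin d)) (A : Mat m d) : ℝ :=
  W x (G x + A) - W x (G x) - inner ℝ (gradF W x (G x)) A

/-- `L(x) = W_FF(x, G(x))`. -/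
noncomputable def tensorL {d m : ℕ} (W : EuclideanSpace ℝ (Fin d) → Mat m d → ℝ)
    (G : EuclideanSpace ℝ (Fin d) → Mat m d)
    (x : EuclideanSpace ℝ (Fin d)) : Mat m d →L[ℝ] Mat m d :=
  hessF W x (G x)

open Classical in
/-- `U(x, A) = |A|⁻² (W°(x, A) - ½ (L(x) A, A))` for `A ≠ 0`, extended by its limit `0` to
`A = 0`. -/
noncomputable def coefU {d m : ℕ} (W : EuclideanSpace ℝ (Fin d) → Mat m d → ℝ)
    (G : EuclideanSpace ℝ (Fin d) → Mat m d)
    (x : EuclideanSpace ℝ (Fin d)) (A : Mat m d) : ℝ :=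
  if A = 0 then 0
  else (Wcirc W G x A - 1 / 2 * inner ℝ (tensorL W G x A) A) / ‖A‖ ^ 2

/-- `𝓕(x, a, A) = W°(x, a A) / a²`, for `a > 0`. -/
noncomputable def scaledF {d m : ℕ} (W : EuclideanSpace ℝ (Fin d) → Mat m d → ℝ)
    (G : EuclideanSpace ℝ (Fin d) → Mat m d)
    (x : EuclideanSpace ℝ (Fin d)) (a : ℝ) (A : Mat m d) : ℝ :=
  Wcirc W G x (a • A) / a ^ 2

/-- `u ∈ W^{1,p}(Ω; ℝ^m)` with weak gradient `Du`. -/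
structure MemW1p {d m : ℕ} (Ω : Set (EuclideanSpace ℝ (Fin d))) (p : ℝ≥0∞)
    (u : EuclideanSpace ℝ (Fin d) → EuclideanSpace ℝ (Fin m))
    (Du : EuclideanSpace ℝ (Fin d) → Mat m d) : Prop where
  memLp : MemLp u p (volume.restrict Ω)
  memLp_grad : MemLp Du p (volume.restrict Ω)
  weak_grad : ∀ φ : EuclideanSpace ℝ (Fin d) → ℝ, ContDiff ℝ ∞ φ → HasCompactSupport φ →
    tsupport φ ⊆ Ω → ∀ (i : Fin m) (j : Fin d),
      ∫ x in Ω, u x i * fderiv ℝ φ x (EuclideanSpace.single j 1) = - ∫ x in Ω, Du x (i, j) * φ x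

/-- The sequence `u n`, with weak gradients `Du n`, is bounded in `W^{1,2}(Ω; ℝ^m)`. -/
def BoundedW12 {d m : ℕ} (Ω : Set (EuclideanSpace ℝ (Fin d)))
    (u : ℕ → EuclideanSpace ℝ (Fin d) → EuclideanSpace ℝ (Fin m))
    (Du : ℕ → EuclideanSpace ℝ (Fin d) → Mat m d) : Prop :=
  ∃ C : ℝ≥0, ∀ n, MemW1p Ω 2 (u n) (Du n) ∧
    eLpNorm (u n) 2 (volume.restrict Ω) ≤ C ∧ eLpNorm (Du n) 2 (volume.restrict Ω) ≤ C

/-- `u n ⇀ 0` weakly in the Hilbert space `W^{1,2}(Ω; ℝ^m)`, whose continuous functionals are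
`u ↦ ∫ (w, u) + ∫ (∇w, ∇u)` with `w ∈ W^{1,2}(Ω; ℝ^m)`. -/
def WeaklyNullW12 {d m : ℕ} (Ω : Set (EuclideanSpace ℝ (Fin d)))
    (u : ℕ → EuclideanSpace ℝ (Fin d) → EuclideanSpace ℝ (Fin m))
    (Du : ℕ → EuclideanSpace ℝ (Fin d) → Mat m d) : Prop :=
  (∀ n, MemW1p Ω 2 (u n) (Du n)) ∧
  ∀ w Dw, MemW1p Ω 2 w Dw →
    Tendsto (fun n => (∫ x in Ω, inner ℝ (w x) (u n x)) + ∫ x in Ω, inner ℝ (Dw x) (Du n x))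
      atTop (𝓝 0)

/-- The sequence `f n` is bounded in `L^∞(Ω; ℝ^{m×d})`. -/
def BoundedLinf {d m : ℕ} (Ω : Set (EuclideanSpace ℝ (Fin d)))
    (f : ℕ → EuclideanSpace ℝ (Fin d) → Mat m d) : Prop :=
  ∃ C : ℝ, ∀ n, ∀ᵐ x ∂(volume.restrict Ω), ‖f n x‖ ≤ C

/-- `ψ n = z n + v n` splits `ψ n` into an oscillating part `z n` with square-equiintegrable
gradients and a concentrating part `v n`, carried by sets `R n` of vanishing measure. -/
structure IsDecomposition {d m : ℕ} (Ω : Set (EuclideanSpace ℝ (Fin d))) (α : ℕ → ℝ)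
    (ψ z v : ℕ → EuclideanSpace ℝ (Fin d) → EuclideanSpace ℝ (Fin m))
    (Dψ Dz Dv : ℕ → EuclideanSpace ℝ (Fin d) → Mat m d)
    (R : ℕ → Set (EuclideanSpace ℝ (Fin d))) : Prop where
  mem_z : ∀ n, MemW1p Ω ∞ (z n) (Dz n)
  mem_v : ∀ n, MemW1p Ω ∞ (v n) (Dv n)
  sum_eq : ∀ n, ∀ᵐ x ∂(volume.restrict Ω), ψ n x = z n x + v n x
  mean_v : ∀ n, ∫ x in Ω, v n x = 0
  equiintegrable : UnifIntegrable (fun n x => ‖Dz n x‖ ^ 2) 1 (volume.restrict Ω)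
  weak_v : WeaklyNullW12 Ω v Dv
  subset_R : ∀ n, R n ⊆ Ω
  measurable_R : ∀ n, NullMeasurableSet (R n) volume
  measure_R : Tendsto (fun n => volume (R n)) atTop (𝓝 0)
  eq_off_R : ∀ n, ∀ᵐ x ∂(volume.restrict Ω), x ∉ R n → z n x = ψ n x ∧ Dz n x = Dψ n x
  bounded_z : BoundedLinf Ω (fun n x => α n • Dz n x)
  bounded_v : BoundedLinf Ω (fun n x => α n • Dv n x)

/-- The sequence `f n` generates the Young measure `ν = {ν_x}` on `Ω`: the `ν_x` are probability
measures depending measurably on `x`, and `h(f n) ⇀ ∫ h dν_x` weakly-* in `L^∞(Ω)` for all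
`h ∈ C₀(ℝ^{m×d})`. -/
structure GeneratesYoung {d m : ℕ} (Ω : Set (EuclideanSpace ℝ (Fin d)))
    (f : ℕ → EuclideanSpace ℝ (Fin d) → Mat m d)
    (ν : EuclideanSpace ℝ (Fin d) → Measure (Mat m d)) : Prop where
  aemeasurable : AEMeasurable ν (volume.restrict Ω)
  isProbability : ∀ᵐ x ∂(volume.restrict Ω), IsProbabilityMeasure (ν x)
  limit : ∀ (h : C₀(Mat m d, ℝ)) (g : EuclideanSpace ℝ (Fin d) → ℝ), IntegrableOn g Ω volume →
    Tendsto (fun n => ∫ x in Ω, g x * h (f n x)) atTop (𝓝 (∫ x in Ω, g x * ∫ A, h A ∂(ν x)))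

/-- `m(x) = ∫ |A|² dν_x(A)`. -/
noncomputable def secondMoment {d m : ℕ} (ν : EuclideanSpace ℝ (Fin d) → Measure (Mat m d))
    (x : EuclideanSpace ℝ (Fin d)) : ℝ :=
  ∫ A, ‖A‖ ^ 2 ∂(ν x)

/-- `f n ⇀ f'` weakly in `L¹(Ω)`; membership of the `f n` and of `f'` in `L¹(Ω)` is included. -/
structure TendstoWeakL1 {d : ℕ} (Ω : Set (EuclideanSpace ℝ (Fin d)))
    (f : ℕ → EuclideanSpace ℝ (Fin d) → ℝ) (f' : EuclideanSpace ℝ (Fin d) → ℝ) : Prop where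
  integrable : ∀ n, IntegrableOn (f n) Ω volume
  integrable_limit : IntegrableOn f' Ω volume
  limit : ∀ g : EuclideanSpace ℝ (Fin d) → ℝ, MemLp g ∞ (volume.restrict Ω) →
    Tendsto (fun n => ∫ x in Ω, f n x * g x) atTop (𝓝 (∫ x in Ω, f' x * g x))

end VarLimit

/-! By Taylor's formula the rescaled energy splits into `½ (L ∇z_n, ∇z_n)` and a remainder `U(x, α_n
∇z_n) |∇z_n|²`, and the two are treated separately.

The remainder vanishes in the limit. Compactness of the closure of `Ω` makes `U(x, A)` uniformly
small for `|A| ≤ δ`, and the `L^∞` bound on `α_n ∇z_n` keeps `U` bounded elsewhere. Where `|α_n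
∇z_n| > δ`, one has `|∇z_n| > k` as soon as `α_n k < δ`, and equiintegrability makes the integral of
`|∇z_n|²` over that set small.

In the quadratic part the entries of `L` are bounded and measurable, so they are absorbed into the
test function. What remains are the functions `A_p A_q`, which do not depend on `x`. The Young
measure of `∇ψ_n` represents their limits along `∇z_n`: a cut-off puts them in `C₀`, the sets where
`∇z_n ≠ ∇ψ_n` have vanishing measure and do not affect bounded integrands, and the tails are
uniformly small (`IsEquiintegrableModification.tendsto_integral_mul_comp`). Integrability of the
second moments follows from the `L²` bound by monotone convergence of truncations. -/

namespace VarLimit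

/-! ### Truncation of functions of quadratic growth -/

section Cutoff

variable {E : Type*} [NormedAddCommGroup E]

/-- A continuous cut-off function: `1` on the ball of radius `k`, `0` off the ball of radius
`k + 1`. -/
noncomputable def cutoff (k : ℕ) (A : E) : ℝ := max 0 (min 1 (k + 1 - ‖A‖))

lemma continuous_cutoff (k : ℕ) : Continuous (cutoff k : E → ℝ) := by
  unfold cutoff; fun_prop

lemma cutoff_nonneg (k : ℕ) (A : E) : 0 ≤ cutoff k A := le_max_left _ _

lemma cutoff_le_one (k : ℕ) (A : E) : cutoff k A ≤ 1 :=
  max_le zero_le_one (min_le_left _ _)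

lemma cutoff_eq_one {k : ℕ} {A : E} (h : ‖A‖ ≤ k) : cutoff k A = 1 := by
  unfold cutoff
  rw [min_eq_left (by linarith), max_eq_right zero_le_one]

lemma cutoff_eq_zero {k : ℕ} {A : E} (h : (k : ℝ) + 1 ≤ ‖A‖) : cutoff k A = 0 :=
  max_eq_left ((min_le_right _ _).trans (by linarith))

lemma cutoff_mono (A : E) : Monotone (fun k : ℕ => cutoff k A) := by
  intro k l hkl
  have : (k : ℝ) ≤ l := by exact_mod_cast hkl
  exact max_le_max le_rfl (min_le_min le_rfl (by linarith))

lemma eventually_cutoff_eq_one (A : E) : ∀ᶠ k : ℕ in atTop, cutoff k A = 1 := by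
  obtain ⟨k₀, hk₀⟩ := exists_nat_ge ‖A‖
  filter_upwards [eventually_ge_atTop k₀] with k hk
  exact cutoff_eq_one (hk₀.trans (by exact_mod_cast hk))

/-- The truncation `cutoff k * h` of a continuous function, as an element of `C₀`. -/
noncomputable def truncation [ProperSpace E] (h : E → ℝ) (hc : Continuous h) (k : ℕ) :
    C₀(E, ℝ) where
  toFun A := cutoff k A * h A
  continuous_toFun := (continuous_cutoff k).mul hc
  zero_at_infty' := by
    apply HasCompactSupport.is_zero_at_infty
    refine HasCompactSupport.of_support_subset_isCompact
      (isCompact_closedBall (0 : E) ((k : ℝ) + 1)) fun A hA => ?_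
    rw [mem_closedBall_zero_iff]
    by_contra hlt
    exact hA (by simp [cutoff_eq_zero (not_le.1 hlt).le])

@[simp] lemma truncation_apply [ProperSpace E] (h : E → ℝ) (hc : Continuous h) (k : ℕ) (A : E) :
    truncation h hc k A = cutoff k A * h A := rfl

open Classical in
/-- `|A|²` restricted to `{|A| > k}`. -/
noncomputable def tailSq (k : ℕ) (A : E) : ℝ := if (k : ℝ) < ‖A‖ then ‖A‖ ^ 2 else 0

lemma tailSq_nonneg (k : ℕ) (A : E) : 0 ≤ tailSq k A := by
  unfold tailSq; split_ifs <;> positivity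

lemma tailSq_le (k : ℕ) (A : E) : tailSq k A ≤ ‖A‖ ^ 2 := by
  unfold tailSq; split_ifs
  · exact le_rfl
  · positivity

lemma sq_le_add_tailSq (k : ℕ) (A : E) : ‖A‖ ^ 2 ≤ (k : ℝ) ^ 2 + tailSq k A := by
  unfold tailSq; split_ifs with h
  · nlinarith [sq_nonneg (k : ℝ)]
  · rw [add_zero]
    exact pow_le_pow_left₀ (norm_nonneg _) (not_lt.1 h) 2

lemma tailSq_anti {k l : ℕ} (hkl : k ≤ l) (A : E) : tailSq l A ≤ tailSq k A := by
  have : (k : ℝ) ≤ l := by exact_mod_cast hkl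
  by_cases h : (l : ℝ) < ‖A‖
  · rw [tailSq, tailSq, if_pos h, if_pos (this.trans_lt h)]
  · rw [tailSq, if_neg h]
    exact tailSq_nonneg k A

/-- The cut-off acts only where `|A| > k`, and there it removes a fraction of `h`. The resulting
bound is independent of `h`, so a single tail estimate serves every integrand. -/
lemma abs_sub_truncation_le [ProperSpace E] {h : E → ℝ} (hc : Continuous h)
    (hle : ∀ A, |h A| ≤ ‖A‖ ^ 2) (k : ℕ) (A : E) :
    |h A - truncation h hc k A| ≤ tailSq k A := by
  rw [truncation_apply, show h A - cutoff k A * h A = (1 - cutoff k A) * h A by ring, abs_mul,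
    abs_of_nonneg (sub_nonneg.2 (cutoff_le_one k A))]
  by_cases hk : (k : ℝ) < ‖A‖
  · rw [tailSq, if_pos hk]
    have := cutoff_nonneg k A
    have := hle A
    nlinarith [abs_nonneg (h A)]
  · rw [tailSq, if_neg hk, cutoff_eq_one (not_lt.1 hk)]
    simp

end Cutoff

/-! ### Young measures tested with functions of quadratic growth -/

section YoungMeasure

variable {X E : Type*} [MeasurableSpace X] {μ : Measure X} [NormedAddCommGroup E]

/-- The sequence `f n` has equiintegrable squares, and differs only on sets of vanishing measure
from the sequence `g n`, which is bounded in `L²`. -/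
structure IsEquiintegrableModification (μ : Measure X) (f g : ℕ → X → E) : Prop where
  memLp : ∀ n, MemLp (f n) 2 μ
  aestronglyMeasurable : ∀ n, AEStronglyMeasurable (g n) μ
  bounded : ∃ C : ℝ≥0, ∀ n, eLpNorm (g n) 2 μ ≤ C
  unifIntegrable : UnifIntegrable (fun n x => ‖f n x‖ ^ 2) 1 μ
  measure_ne : Tendsto (fun n => μ {x | f n x ≠ g n x}) atTop (𝓝 0)

lemma integrable_tailSq {f : X → E}
    (hf : MemLp f 2 μ) (k : ℕ) : Integrable (fun x => tailSq k (f x)) μ := by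
  have h2 : Integrable (fun x => ‖f x‖ ^ 2) μ := hf.norm.integrable_sq
  refine h2.mono' ?_ (ae_of_all _ fun x => ?_)
  · have : AEMeasurable (fun x => tailSq k (f x)) μ := by
      have h1 : AEMeasurable (fun x => ‖f x‖) μ := hf.1.norm.aemeasurable
      unfold tailSq
      have : Measurable (fun t : ℝ => if (k : ℝ) < t then t ^ 2 else 0) :=
        Measurable.ite measurableSet_Ioi (by fun_prop) measurable_const
      convert! this.comp_aemeasurable h1 using 3
    exact this.aestronglyMeasurable
  · rw [Real.norm_of_nonneg (tailSq_nonneg _ _)]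
    exact tailSq_le _ _

/-- Chebyshev's inequality. The right-hand side does not depend on `g` beyond its `L²` bound, hence
is uniform along a bounded sequence. -/
lemma measure_norm_gt_le {g : X → E} (hg : AEStronglyMeasurable g μ) {C : ℝ≥0}
    (hC : eLpNorm g 2 μ ≤ C) {k : ℕ} (hk : 0 < k) :
    μ {x | (k : ℝ) < ‖g x‖} ≤ ((k : ℝ≥0∞)⁻¹ * C) ^ 2 := by
  have h := meas_ge_le_mul_pow_eLpNorm_enorm μ two_ne_zero ENNReal.ofNat_ne_top hg
    (ε := (k : ℝ≥0∞)) (by exact_mod_cast hk.ne') (by simp)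
  refine (measure_mono fun x (hx : (k : ℝ) < ‖g x‖) => ?_).trans (h.trans ?_)
  · show (k : ℝ≥0∞) ≤ ‖g x‖ₑ
    rw [← ofReal_norm, ← ENNReal.ofReal_natCast]
    exact ENNReal.ofReal_le_ofReal hx.le
  · simp only [ENNReal.toReal_ofNat, ENNReal.rpow_two]
    rw [mul_pow]
    gcongr

/-- The set `{|f n| > k₀}` lies in `{f n ≠ g n} ∪ {|g n| > k₀}`. The first set is small for large
`n` and the second, by Chebyshev, for large `k₀`; equiintegrability then applies. Tails decrease in
`k`, so larger `k` cost nothing. -/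
lemma IsEquiintegrableModification.exists_integral_tailSq_le
    {f g : ℕ → X → E} (H : IsEquiintegrableModification μ f g) {ε : ℝ} (hε : 0 < ε) :
    ∃ k₀ : ℕ, ∀ k ≥ k₀, ∀ᶠ n in atTop, ∫ x, tailSq k (f n x) ∂μ ≤ ε := by
  obtain ⟨δ, hδ, hs⟩ := H.unifIntegrable hε
  obtain ⟨C, hC⟩ := H.bounded
  have hδ2 : (0 : ℝ≥0∞) < ENNReal.ofReal (δ / 2) := by simpa using hδ
  have hlim : Tendsto (fun k : ℕ => ((k : ℝ≥0∞)⁻¹ * C) ^ 2) atTop (𝓝 0) := by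
    have h1 : Tendsto (fun k : ℕ => (k : ℝ≥0∞)⁻¹ * C) atTop (𝓝 (0 * C)) :=
      ENNReal.Tendsto.mul_const ENNReal.tendsto_inv_nat_nhds_zero (Or.inr ENNReal.coe_ne_top)
    simpa using ENNReal.Tendsto.pow (n := 2) h1
  obtain ⟨k₀, hk₀, hk₀pos⟩ := ((hlim.eventually (gt_mem_nhds hδ2)).and
    (eventually_gt_atTop 0)).exists
  refine ⟨k₀, fun k hk => ?_⟩
  filter_upwards [H.measure_ne.eventually (gt_mem_nhds hδ2)] with n hn
  refine (integral_mono (integrable_tailSq (H.memLp n) k) (integrable_tailSq (H.memLp n) k₀)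
    fun x => tailSq_anti hk _).trans ?_
  set S : Set X := {x | (k₀ : ℝ) < ‖f n x‖}
  -- Equiintegrability is tested on measurable sets, so `S` is replaced by a measurable hull of the
  -- same measure.
  have hS : μ (toMeasurable μ S) ≤ ENNReal.ofReal δ := by
    rw [measure_toMeasurable]
    have hsub : S ⊆ {x | f n x ≠ g n x} ∪ {x | (k₀ : ℝ) < ‖g n x‖} := by
      intro x hx
      by_cases hfg : f n x = g n x
      · right
        show (k₀ : ℝ) < ‖g n x‖
        rw [← hfg]; exact hx
      · left; exact hfg
    calc μ S ≤ μ {x | f n x ≠ g n x} + μ {x | (k₀ : ℝ) < ‖g n x‖} :=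
          (measure_mono hsub).trans (measure_union_le _ _)
      _ ≤ ENNReal.ofReal (δ / 2) + ENNReal.ofReal (δ / 2) :=
          add_le_add hn.le ((measure_norm_gt_le (H.aestronglyMeasurable n) (hC n) hk₀pos).trans
            hk₀.le)
      _ = ENNReal.ofReal δ := by
          rw [← ENNReal.ofReal_add (by positivity) (by positivity), add_halves]
  have h1 := hs n _ (measurableSet_toMeasurable μ S) hS
  rw [eLpNorm_one_eq_lintegral_enorm] at h1
  rw [integral_eq_lintegral_of_nonneg_ae (ae_of_all _ fun x => tailSq_nonneg _ _)
    (integrable_tailSq (H.memLp n) k₀).1]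
  refine ENNReal.toReal_le_of_le_ofReal hε.le (le_trans (lintegral_mono fun x => ?_) h1)
  by_cases hx : (k₀ : ℝ) < ‖f n x‖
  · rw [Set.indicator_of_mem (subset_toMeasurable μ S hx), tailSq, if_pos hx,
      Real.enorm_of_nonneg (by positivity)]
  · rw [tailSq, if_neg hx]; simp

/-- On a finite measure space, a uniform bound on one tail already bounds the full integral, since
the rest is at most `k²`. -/
lemma IsEquiintegrableModification.exists_integral_sq_le
    [IsFiniteMeasure μ] {f g : ℕ → X → E} (H : IsEquiintegrableModification μ f g) :
    ∃ C : ℝ, ∀ᶠ n in atTop, ∫ x, ‖f n x‖ ^ 2 ∂μ ≤ C := by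
  obtain ⟨k, hk⟩ := H.exists_integral_tailSq_le one_pos
  refine ⟨μ.real Set.univ * (k : ℝ) ^ 2 + 1, ?_⟩
  filter_upwards [hk k le_rfl] with n hn
  have hi := integrable_tailSq (H.memLp n) k
  calc ∫ x, ‖f n x‖ ^ 2 ∂μ ≤ ∫ x, ((k : ℝ) ^ 2 + tailSq k (f n x)) ∂μ :=
        integral_mono (H.memLp n).norm.integrable_sq ((integrable_const _).add hi)
          fun x => sq_le_add_tailSq k _
    _ ≤ _ := by
        rw [integral_add (integrable_const _) hi, integral_const, smul_eq_mul]
        gcongr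

lemma integrable_comp_of_le_sq {f : X → E} (hf : MemLp f 2 μ) {h : E → ℝ} (hc : Continuous h)
    (hle : ∀ A, |h A| ≤ ‖A‖ ^ 2) : Integrable (fun x => h (f x)) μ :=
  hf.norm.integrable_sq.mono' (hc.comp_aestronglyMeasurable hf.1) (ae_of_all _ fun _ => hle _)

lemma norm_integral_mul_le {φ u w : X → ℝ} {B : ℝ} (hB : ∀ᵐ x ∂μ, ‖φ x‖ ≤ B)
    (hw : Integrable w μ) (hu : ∀ᵐ x ∂μ, ‖u x‖ ≤ w x) :
    ‖∫ x, φ x * u x ∂μ‖ ≤ B * ∫ x, w x ∂μ := by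
  rw [← integral_const_mul]
  refine norm_integral_le_of_norm_le (hw.const_mul B) ?_
  filter_upwards [hB, hu] with x h1 h2
  rw [norm_mul]
  exact mul_le_mul h1 h2 (norm_nonneg _) ((norm_nonneg _).trans h1)

/-- The integrand vanishes off `{f n ≠ g n}` and the bracket is at most `2 ‖h‖` on it; only
boundedness of `h` matters. -/
lemma IsEquiintegrableModification.tendsto_integral_sub_comp [IsFiniteMeasure μ]
    {f g : ℕ → X → E} (H : IsEquiintegrableModification μ f g)
    {φ : X → ℝ} {B : ℝ} (hB : ∀ᵐ x ∂μ, ‖φ x‖ ≤ B) (h : C₀(E, ℝ)) :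
    Tendsto (fun n => ∫ x, φ x * (h (f n x) - h (g n x)) ∂μ) atTop (𝓝 0) := by
  have hlim : Tendsto (fun n => B * (2 * ‖h.toBCF‖ * (μ {x | f n x ≠ g n x}).toReal)) atTop
      (𝓝 0) := by
    have := (ENNReal.tendsto_toReal ENNReal.zero_ne_top).comp H.measure_ne
    simpa using (this.const_mul (2 * ‖h.toBCF‖)).const_mul B
  refine squeeze_zero_norm (fun n => ?_) hlim
  set S : Set X := {x | f n x ≠ g n x}
  refine (norm_integral_mul_le (w := (toMeasurable μ S).indicator fun _ => 2 * ‖h.toBCF‖) hB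
    ((integrable_const _).indicator (measurableSet_toMeasurable μ S))
    (ae_of_all _ fun x => ?_)).trans (le_of_eq ?_)
  · by_cases hx : f n x = g n x
    · rw [hx, sub_self, norm_zero]
      exact Set.indicator_nonneg (fun _ _ => by positivity) _
    · rw [Set.indicator_of_mem (subset_toMeasurable μ S hx), two_mul]
      exact (norm_sub_le _ _).trans
        (add_le_add (h.toBCF.norm_coe_le_norm _) (h.toBCF.norm_coe_le_norm _))
  · rw [integral_indicator (measurableSet_toMeasurable μ S), setIntegral_const, measureReal_def,
      measure_toMeasurable, smul_eq_mul]
    ring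

/-- Measurability of `ν` gives measurability of lower integrals of nonnegative functions, hence the
splitting into positive and negative parts. -/
lemma aestronglyMeasurable_integral_measure {F : Type*} [MeasurableSpace F] {ν : X → Measure F}
    (hν : AEMeasurable ν μ) {h : F → ℝ} (hh : Measurable h) (hi : ∀ᵐ x ∂μ, Integrable h (ν x)) :
    AEStronglyMeasurable (fun x => ∫ A, h A ∂(ν x)) μ := by
  have hp : AEMeasurable (fun x => ∫⁻ A, .ofReal (h A) ∂(ν x)) μ :=
    (Measure.measurable_lintegral hh.ennreal_ofReal).comp_aemeasurable hν
  have hm : AEMeasurable (fun x => ∫⁻ A, .ofReal (-h A) ∂(ν x)) μ :=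
    (Measure.measurable_lintegral hh.neg.ennreal_ofReal).comp_aemeasurable hν
  refine (hp.ennreal_toReal.sub hm.ennreal_toReal).aestronglyMeasurable.congr ?_
  filter_upwards [hi] with x hx
  exact (integral_eq_lintegral_pos_part_sub_lintegral_neg_part hx).symm

variable [MeasurableSpace E] {ν : X → Measure E}

lemma ae_norm_integral_zeroAtInfty_le (hprob : ∀ᵐ x ∂μ, IsProbabilityMeasure (ν x))
    (h : C₀(E, ℝ)) : ∀ᵐ x ∂μ, ‖∫ A, h A ∂(ν x)‖ ≤ ‖h.toBCF‖ := by
  filter_upwards [hprob] with x hx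
  have := norm_integral_le_of_norm_le_const (μ := ν x) (f := fun A => h A) (C := ‖h.toBCF‖)
    (ae_of_all _ fun A => h.toBCF.norm_coe_le_norm A)
  simpa using this

variable [BorelSpace E]

lemma ae_integrable_zeroAtInfty (hprob : ∀ᵐ x ∂μ, IsProbabilityMeasure (ν x)) (h : C₀(E, ℝ)) :
    ∀ᵐ x ∂μ, Integrable (fun A => h A) (ν x) := by
  filter_upwards [hprob] with x hx
  refine Integrable.of_bound h.continuous.measurable.aestronglyMeasurable ‖h.toBCF‖
    (ae_of_all _ fun A => ?_)
  exact h.toBCF.norm_coe_le_norm A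

/-- The second moments of the Young measure generated by a sequence bounded in `L²` are
integrable. -/
lemma lintegral_lintegral_enorm_sq_lt_top [ProperSpace E] [IsFiniteMeasure μ] {g : ℕ → X → E}
    (hν : AEMeasurable ν μ) (hprob : ∀ᵐ x ∂μ, IsProbabilityMeasure (ν x))
    (hlim : ∀ h : C₀(E, ℝ),
      Tendsto (fun n => ∫ x, h (g n x) ∂μ) atTop (𝓝 (∫ x, ∫ A, h A ∂(ν x) ∂μ)))
    (hg : ∀ n, AEStronglyMeasurable (g n) μ) {C : ℝ≥0} (hC : ∀ n, eLpNorm (g n) 2 μ ≤ C) :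
    ∫⁻ x, ∫⁻ A, ENNReal.ofReal (‖A‖ ^ 2) ∂(ν x) ∂μ < ⊤ := by
  have hc : Continuous fun A : E => ‖A‖ ^ 2 := by fun_prop
  have hgm : ∀ n, MemLp (g n) 2 μ := fun n => ⟨hg n, (hC n).trans_lt ENNReal.coe_lt_top⟩
  have hnn : ∀ k (A : E), 0 ≤ truncation _ hc k A := fun k A =>
    mul_nonneg (cutoff_nonneg k A) (by positivity)
  have hsq : ∀ n, ∫ x, ‖g n x‖ ^ 2 ∂μ ≤ (C : ℝ) ^ 2 := by
    intro n
    have h1 := (hgm n).eLpNorm_eq_integral_rpow_norm two_ne_zero ENNReal.ofNat_ne_top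
    have h2 := hC n
    simp only [ENNReal.toReal_ofNat, Real.rpow_two] at h1
    rw [h1, ← ENNReal.ofReal_coe_nnreal] at h2
    replace h2 := (ENNReal.ofReal_le_ofReal_iff C.2).1 h2
    have h0 : 0 ≤ ∫ x, ‖g n x‖ ^ 2 ∂μ := integral_nonneg fun x => by positivity
    have h3 := pow_le_pow_left₀ (by positivity) h2 2
    rwa [← Real.rpow_natCast, ← Real.rpow_mul h0, show (2 : ℝ)⁻¹ * ((2 : ℕ) : ℝ) = 1 by norm_num,
      Real.rpow_one] at h3
  -- Each truncation is an admissible test function lying below `|A|²`, so the `L²` bound passes to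
  -- the limit in `n` uniformly in `k`.
  have hk : ∀ k, ∫ x, ∫ A, truncation _ hc k A ∂(ν x) ∂μ ≤ (C : ℝ) ^ 2 := by
    intro k
    refine le_of_tendsto' (hlim (truncation _ hc k)) fun n => le_trans ?_ (hsq n)
    refine integral_mono_of_nonneg (ae_of_all _ fun x => hnn k _) (hgm n).norm.integrable_sq
      (ae_of_all _ fun x => ?_)
    exact mul_le_of_le_one_left (by positivity) (cutoff_le_one k _)
  -- Against the mixture `μ.bind ν` the iterated integral becomes a single one, and monotone
  -- convergence in `k` is used once.
  rw [← Measure.lintegral_bind (f := fun A => ENNReal.ofReal (‖A‖ ^ 2)) hν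
    hc.measurable.ennreal_ofReal.aemeasurable]
  have hbound : ∀ k, ∫⁻ A, ENNReal.ofReal (truncation _ hc k A) ∂(μ.bind ν)
      ≤ ENNReal.ofReal ((C : ℝ) ^ 2) := by
    intro k
    rw [Measure.lintegral_bind (f := fun A => ENNReal.ofReal (truncation _ hc k A)) hν
      (truncation _ hc k).continuous.measurable.ennreal_ofReal.aemeasurable]
    refine le_trans (le_of_eq ?_) (ENNReal.ofReal_le_ofReal (hk k))
    rw [ofReal_integral_eq_lintegral_ofReal]
    · refine lintegral_congr_ae ?_
      filter_upwards [ae_integrable_zeroAtInfty hprob (truncation _ hc k)] with x hx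
      rw [ofReal_integral_eq_lintegral_ofReal hx (ae_of_all _ fun A => hnn k A)]
    · exact Integrable.of_bound (aestronglyMeasurable_integral_measure hν
        (truncation _ hc k).continuous.measurable (ae_integrable_zeroAtInfty hprob _)) _
        (ae_norm_integral_zeroAtInfty_le hprob _)
    · exact ae_of_all _ fun x => integral_nonneg fun A => hnn k A
  refine lt_of_le_of_lt (le_of_tendsto' (lintegral_tendsto_of_tendsto_of_monotone
    (f := fun k A => ENNReal.ofReal (truncation _ hc k A)) (fun k =>
      (truncation _ hc k).continuous.measurable.ennreal_ofReal.aemeasurable)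
    (ae_of_all _ fun A k l hkl => ?_) (ae_of_all _ fun A => ?_)) hbound) ENNReal.ofReal_lt_top
  · refine ENNReal.ofReal_le_ofReal (mul_le_mul_of_nonneg_right (cutoff_mono A hkl) ?_)
    positivity
  · refine tendsto_const_nhds.congr' ?_
    filter_upwards [eventually_cutoff_eq_one A] with k hk
    simp [hk]

lemma ae_integrable_norm_sq (hν : AEMeasurable ν μ)
    (h2 : ∫⁻ x, ∫⁻ A, ENNReal.ofReal (‖A‖ ^ 2) ∂(ν x) ∂μ < ⊤) :
    ∀ᵐ x ∂μ, Integrable (fun A : E => ‖A‖ ^ 2) (ν x) := by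
  have hc : Continuous fun A : E => ‖A‖ ^ 2 := by fun_prop
  filter_upwards [ae_lt_top' ((Measure.measurable_lintegral
    hc.measurable.ennreal_ofReal).comp_aemeasurable hν) h2.ne] with x hx
  refine ⟨hc.measurable.aestronglyMeasurable, ?_⟩
  rw [hasFiniteIntegral_iff_ofReal (ae_of_all _ fun A => by positivity)]
  exact hx

lemma integrable_integral_norm_sq (hν : AEMeasurable ν μ)
    (h2 : ∫⁻ x, ∫⁻ A, ENNReal.ofReal (‖A‖ ^ 2) ∂(ν x) ∂μ < ⊤) :
    Integrable (fun x => ∫ A, ‖A‖ ^ 2 ∂(ν x)) μ := by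
  have hc : Continuous fun A : E => ‖A‖ ^ 2 := by fun_prop
  refine ⟨aestronglyMeasurable_integral_measure hν hc.measurable
    (ae_integrable_norm_sq hν h2), ?_⟩
  rw [hasFiniteIntegral_iff_ofReal (ae_of_all _ fun x => integral_nonneg fun A => by positivity)]
  refine lt_of_le_of_lt (lintegral_mono_ae ?_) h2
  filter_upwards [ae_integrable_norm_sq hν h2] with x hx
  rw [ofReal_integral_eq_lintegral_ofReal hx (ae_of_all _ fun A => by positivity)]

lemma ae_norm_integral_le_secondMoment (hν : AEMeasurable ν μ)
    (h2 : ∫⁻ x, ∫⁻ A, ENNReal.ofReal (‖A‖ ^ 2) ∂(ν x) ∂μ < ⊤) :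
    ∀ᵐ x ∂μ, ∀ h : E → ℝ, (∀ A, |h A| ≤ ‖A‖ ^ 2) →
      ‖∫ A, h A ∂(ν x)‖ ≤ ∫ A, ‖A‖ ^ 2 ∂(ν x) := by
  filter_upwards [ae_integrable_norm_sq hν h2] with x hx h hle
  exact norm_integral_le_of_norm_le hx (ae_of_all _ fun A => hle A)

lemma integrable_integral_of_le_sq (hν : AEMeasurable ν μ)
    (h2 : ∫⁻ x, ∫⁻ A, ENNReal.ofReal (‖A‖ ^ 2) ∂(ν x) ∂μ < ⊤) {h : E → ℝ} (hh : Measurable h)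
    (hle : ∀ A, |h A| ≤ ‖A‖ ^ 2) : Integrable (fun x => ∫ A, h A ∂(ν x)) μ := by
  refine (integrable_integral_norm_sq hν h2).mono' (aestronglyMeasurable_integral_measure hν hh ?_)
    ?_
  · filter_upwards [ae_integrable_norm_sq hν h2] with x hx
    exact hx.mono' hh.aestronglyMeasurable (ae_of_all _ hle)
  · filter_upwards [ae_norm_integral_le_secondMoment hν h2] with x hx
    exact hx h hle

/-- Dominated convergence twice: under `ν x` with majorant `|A|²`, then in `x` with majorant `B`
times the second moment. -/
lemma tendsto_integral_mul_integral_truncation [ProperSpace E] (hν : AEMeasurable ν μ)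
    (hprob : ∀ᵐ x ∂μ, IsProbabilityMeasure (ν x))
    (h2 : ∫⁻ x, ∫⁻ A, ENNReal.ofReal (‖A‖ ^ 2) ∂(ν x) ∂μ < ⊤)
    {φ : X → ℝ} (hφ : AEStronglyMeasurable φ μ) {B : ℝ} (hB : ∀ᵐ x ∂μ, ‖φ x‖ ≤ B)
    {h : E → ℝ} (hc : Continuous h) (hle : ∀ A, |h A| ≤ ‖A‖ ^ 2) :
    Tendsto (fun k => ∫ x, φ x * ∫ A, truncation h hc k A ∂(ν x) ∂μ) atTop
      (𝓝 (∫ x, φ x * ∫ A, h A ∂(ν x) ∂μ)) := by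
  have hle' : ∀ k A, |truncation h hc k A| ≤ ‖A‖ ^ 2 := fun k A => by
    rw [truncation_apply, abs_mul, abs_of_nonneg (cutoff_nonneg k A)]
    exact (mul_le_of_le_one_left (abs_nonneg _) (cutoff_le_one k A)).trans (hle A)
  refine tendsto_integral_of_dominated_convergence (fun x => B * ∫ A, ‖A‖ ^ 2 ∂(ν x))
    (fun k => hφ.mul (aestronglyMeasurable_integral_measure hν
      (truncation h hc k).continuous.measurable (ae_integrable_zeroAtInfty hprob _)))
    ((integrable_integral_norm_sq hν h2).const_mul B) (fun k => ?_) ?_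
  · filter_upwards [hB, ae_norm_integral_le_secondMoment hν h2] with x hx hx2
    rw [norm_mul]
    exact mul_le_mul hx (hx2 _ (hle' k)) (norm_nonneg _) ((norm_nonneg _).trans hx)
  · filter_upwards [ae_integrable_norm_sq hν h2] with x hx
    refine Tendsto.const_mul _ (tendsto_integral_of_dominated_convergence _
      (fun k => (truncation h hc k).continuous.measurable.aestronglyMeasurable) hx
      (fun k => ae_of_all _ (hle' k)) (ae_of_all _ fun A => ?_))
    refine tendsto_const_nhds.congr' ?_
    filter_upwards [eventually_cutoff_eq_one A] with k hk
    simp [hk]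

/-- If `g n` generates the Young measure `ν`, and `f n` has equiintegrable squares and differs from
`g n` on sets of vanishing measure, then `h (f n) ⇀ ∫ h dν_x` weakly in `L¹` for continuous `h` of
at most quadratic growth. -/
lemma IsEquiintegrableModification.tendsto_integral_mul_comp [ProperSpace E] [IsFiniteMeasure μ]
    {f g : ℕ → X → E} (H : IsEquiintegrableModification μ f g)
    (hν : AEMeasurable ν μ) (hprob : ∀ᵐ x ∂μ, IsProbabilityMeasure (ν x))
    (hlim : ∀ (h : C₀(E, ℝ)) (φ : X → ℝ), Integrable φ μ →
      Tendsto (fun n => ∫ x, φ x * h (g n x) ∂μ) atTop (𝓝 (∫ x, φ x * ∫ A, h A ∂(ν x) ∂μ)))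
    (h2 : ∫⁻ x, ∫⁻ A, ENNReal.ofReal (‖A‖ ^ 2) ∂(ν x) ∂μ < ⊤)
    {φ : X → ℝ} (hφ : AEStronglyMeasurable φ μ) {B : ℝ} (hB : ∀ᵐ x ∂μ, ‖φ x‖ ≤ B)
    {h : E → ℝ} (hc : Continuous h) (hle : ∀ A, |h A| ≤ ‖A‖ ^ 2) :
    Tendsto (fun n => ∫ x, φ x * h (f n x) ∂μ) atTop (𝓝 (∫ x, φ x * ∫ A, h A ∂(ν x) ∂μ)) := by
  have hφi : Integrable φ μ := Integrable.of_bound hφ B hB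
  rw [Metric.tendsto_atTop']
  intro ε hε
  -- A strictly positive bound for `φ`, so that division by it is legitimate.
  set b : ℝ := max B 0 + 1
  have hb : 0 < b := by positivity
  have hBb : ∀ᵐ x ∂μ, ‖φ x‖ ≤ b := by
    filter_upwards [hB] with x hx
    exact hx.trans ((le_max_left B 0).trans (le_add_of_nonneg_right zero_le_one))
  -- Four errors of size `ε / 4`: truncating `h` along `f n`, replacing `f n` by `g n`, the weak-*
  -- limit for the truncation, and truncating under `ν`. The level `k` is fixed before `n`.
  obtain ⟨k₀, hk₀⟩ := H.exists_integral_tailSq_le (show 0 < ε / 4 / b by positivity)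
  have hk1 := (tendsto_integral_mul_integral_truncation hν hprob h2 hφ hB hc hle).eventually
    (Metric.ball_mem_nhds _ (show 0 < ε / 4 by positivity))
  obtain ⟨k, hk, hkk⟩ := (hk1.and (eventually_ge_atTop k₀)).exists
  rw [Real.dist_eq] at hk
  have hn1 := (H.tendsto_integral_sub_comp hB (truncation h hc k)).eventually
    (Metric.ball_mem_nhds _ (show 0 < ε / 4 by positivity))
  have hn2 := (hlim (truncation h hc k) φ hφi).eventually
    (Metric.ball_mem_nhds _ (show 0 < ε / 4 by positivity))
  obtain ⟨N, hN⟩ := eventually_atTop.1 ((hk₀ k hkk).and (hn1.and hn2))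
  refine ⟨N, fun n hn => ?_⟩
  obtain ⟨ht, h1, h3⟩ := hN n hn.le
  rw [Real.dist_eq] at h1 h3
  rw [Real.dist_eq]
  have hcomp : ∀ u : X → E, AEStronglyMeasurable u μ →
      Integrable (fun x => φ x * truncation h hc k (u x)) μ := fun u hu =>
    hφi.mul_bdd (c := ‖(truncation h hc k).toBCF‖)
      ((truncation h hc k).continuous.comp_aestronglyMeasurable hu)
      (ae_of_all _ fun x => (truncation h hc k).toBCF.norm_coe_le_norm _)
  have hif := hcomp _ (H.memLp n).1
  have hig := hcomp _ (H.aestronglyMeasurable n)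
  have hih : Integrable (fun x => φ x * h (f n x)) μ :=
    (integrable_comp_of_le_sq (H.memLp n) hc hle).bdd_mul hφ hB
  have h0 : |∫ x, φ x * (h (f n x) - truncation h hc k (f n x)) ∂μ| ≤ ε / 4 := by
    refine (norm_integral_mul_le hBb (integrable_tailSq (H.memLp n) k)
      (ae_of_all _ fun x => abs_sub_truncation_le hc hle k _)).trans ?_
    calc b * _ ≤ b * (ε / 4 / b) := by gcongr
      _ = ε / 4 := by field_simp
  have e0 : ∫ x, φ x * (h (f n x) - truncation h hc k (f n x)) ∂μ
      = (∫ x, φ x * h (f n x) ∂μ) - ∫ x, φ x * truncation h hc k (f n x) ∂μ := by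
    rw [← integral_sub hih hif]; simp only [mul_sub]
  have e1 : ∫ x, φ x * (truncation h hc k (f n x) - truncation h hc k (g n x)) ∂μ
      = (∫ x, φ x * truncation h hc k (f n x) ∂μ)
        - ∫ x, φ x * truncation h hc k (g n x) ∂μ := by
    rw [← integral_sub hif hig]; simp only [mul_sub]
  rw [e0] at h0
  rw [e1] at h1
  rw [abs_le] at h0
  rw [abs_lt] at h1 h3 hk ⊢
  constructor <;> linarith [h0.1, h0.2, h1.1, h1.2, h3.1, h3.2, hk.1, hk.2]

end YoungMeasure

/-! ### Uniform second order Taylor estimates for the Lagrangian -/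

section Taylor

variable {d m : ℕ} {Ω : Set (EuclideanSpace ℝ (Fin d))}
  {W : EuclideanSpace ℝ (Fin d) → Mat m d → ℝ} {G : EuclideanSpace ℝ (Fin d) → Mat m d}

/-- The second order Taylor remainder `W°(x, A) - ½ (L(x) A, A)`. -/
noncomputable def remainder (W : EuclideanSpace ℝ (Fin d) → Mat m d → ℝ)
    (G : EuclideanSpace ℝ (Fin d) → Mat m d) (x : EuclideanSpace ℝ (Fin d)) (A : Mat m d) : ℝ :=
  Wcirc W G x A - 1 / 2 * inner ℝ (tensorL W G x A) A

/-- The quadratic term is 2-homogeneous, so division by `a²` leaves it unscaled and only the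
remainder depends on `a`. -/
lemma scaledF_eq (x : EuclideanSpace ℝ (Fin d)) {a : ℝ} (ha : 0 < a) (A : Mat m d) :
    scaledF W G x a A
      = remainder W G x (a • A) / a ^ 2 + 1 / 2 * inner ℝ (tensorL W G x A) A := by
  rw [scaledF, remainder, map_smul, inner_smul_left, inner_smul_right]
  simp only [conj_trivial]
  field_simp
  ring

lemma IsLagrangian.continuousOn_gradF (hW : IsLagrangian Ω W G)
    (hG : ContinuousOn G (closure Ω)) : ContinuousOn (fun x => gradF W x (G x)) (closure Ω) := by
  obtain ⟨O, -, hGO, -, -, hg, -⟩ := hW.c2_on_range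
  exact hg.comp (f := fun x => (x, G x)) (continuousOn_id.prodMk hG) fun x hx => ⟨hx, hGO x hx⟩

lemma IsLagrangian.continuousOn_tensorL (hW : IsLagrangian Ω W G)
    (hG : ContinuousOn G (closure Ω)) : ContinuousOn (tensorL W G) (closure Ω) := by
  obtain ⟨O, -, hGO, -, -, -, hh⟩ := hW.c2_on_range
  exact hh.comp (f := fun x => (x, G x)) (continuousOn_id.prodMk hG) fun x hx => ⟨hx, hGO x hx⟩

lemma IsLagrangian.continuousOn_Wcirc (hW : IsLagrangian Ω W G)
    (hG : ContinuousOn G (closure Ω)) :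
    ContinuousOn (fun p : EuclideanSpace ℝ (Fin d) × Mat m d => Wcirc W G p.1 p.2)
      (closure Ω ×ˢ Set.univ) := by
  have hfst : Set.MapsTo Prod.fst (closure Ω ×ˢ (Set.univ : Set (Mat m d))) (closure Ω) :=
    fun p hp => hp.1
  have hG' : ContinuousOn (fun p : EuclideanSpace ℝ (Fin d) × Mat m d => G p.1)
      (closure Ω ×ˢ Set.univ) := hG.comp continuousOn_fst hfst
  have hg' : ContinuousOn (fun p : EuclideanSpace ℝ (Fin d) × Mat m d => gradF W p.1 (G p.1))
      (closure Ω ×ˢ Set.univ) := (hW.continuousOn_gradF hG).comp continuousOn_fst hfst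
  have h1 : ContinuousOn (fun p : EuclideanSpace ℝ (Fin d) × Mat m d => W p.1 (G p.1 + p.2))
      (closure Ω ×ˢ Set.univ) :=
    hW.continuousOn.comp (f := fun p : EuclideanSpace ℝ (Fin d) × Mat m d => (p.1, G p.1 + p.2))
      (continuousOn_fst.prodMk (hG'.add continuousOn_snd)) fun p hp => ⟨hp.1, trivial⟩
  have h2 : ContinuousOn (fun p : EuclideanSpace ℝ (Fin d) × Mat m d => W p.1 (G p.1))
      (closure Ω ×ˢ Set.univ) :=
    hW.continuousOn.comp (f := fun p : EuclideanSpace ℝ (Fin d) × Mat m d => (p.1, G p.1))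
      (continuousOn_fst.prodMk hG') fun p hp => ⟨hp.1, trivial⟩
  exact (h1.sub h2).sub (hg'.inner continuousOn_snd)

/-- Uniform continuity of `W_FF` along the compact graph of `G`. -/
lemma IsLagrangian.exists_forall_norm_hessF_sub_le (hΩ : IsCompact (closure Ω))
    (hW : IsLagrangian Ω W G) (hG : ContinuousOn G (closure Ω)) {ε : ℝ} (hε : 0 < ε) :
    ∃ δ > 0, ∀ x ∈ closure Ω, ∀ A : Mat m d, ‖A‖ ≤ δ →
      DifferentiableAt ℝ (W x) (G x + A) ∧ DifferentiableAt ℝ (gradF W x) (G x + A) ∧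
      ‖hessF W x (G x + A) - tensorL W G x‖ ≤ ε := by
  obtain ⟨O, hO, hGO, hd1, hd2, -, hh⟩ := hW.c2_on_range
  -- The repeated membership is deliberate: the compactness argument asks for a full neighbourhood
  -- of each `x₀`, while continuity is known only within the closure, so membership must also be a
  -- hypothesis of the local property.
  have key : ∀ᶠ A : Mat m d in 𝓝 0, ∀ x ∈ closure Ω, x ∈ closure Ω →
      G x + A ∈ O ∧ ‖hessF W x (G x + A) - tensorL W G x‖ ≤ ε := by
    refine hΩ.eventually_forall_of_forall_eventually fun x₀ hx₀ => ?_
    set S : Set (Mat m d × EuclideanSpace ℝ (Fin d)) := {p | p.2 ∈ closure Ω}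
    have hG' : ContinuousOn (fun p : Mat m d × EuclideanSpace ℝ (Fin d) => G p.2) S :=
      hG.comp continuousOn_snd fun p hp => hp
    have hpt : ((0 : Mat m d), x₀) ∈ S := hx₀
    have hc : ContinuousWithinAt
        (fun p : Mat m d × EuclideanSpace ℝ (Fin d) => G p.2 + p.1) S (0, x₀) :=
      (hG'.add continuousOn_fst) _ hpt
    have hO' : ∀ᶠ p in 𝓝[S] ((0 : Mat m d), x₀), G p.2 + p.1 ∈ O := by
      refine hc.eventually (hO.mem_nhds ?_)
      simpa using hGO x₀ hx₀
    have ht : Tendsto (fun p : Mat m d × EuclideanSpace ℝ (Fin d) => (p.2, G p.2 + p.1))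
        (𝓝[S] (0, x₀)) (𝓝[closure Ω ×ˢ O] (x₀, G x₀)) := by
      refine tendsto_nhdsWithin_iff.2 ⟨?_, ?_⟩
      · have := (continuousWithinAt_snd (s := S) (p := ((0 : Mat m d), x₀))).prodMk hc
        simpa [ContinuousWithinAt] using this
      · filter_upwards [hO', self_mem_nhdsWithin] with p h1 h2
        exact ⟨h2, h1⟩
    have hlim : Tendsto (fun p : Mat m d × EuclideanSpace ℝ (Fin d) =>
        hessF W p.2 (G p.2 + p.1) - tensorL W G p.2) (𝓝[S] (0, x₀)) (𝓝 0) := by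
      have h1 := (hh (x₀, G x₀) ⟨hx₀, hGO x₀ hx₀⟩).tendsto.comp ht
      have h2 : ContinuousOn (fun p : Mat m d × EuclideanSpace ℝ (Fin d) => tensorL W G p.2) S :=
        (hW.continuousOn_tensorL hG).comp continuousOn_snd fun p hp => hp
      have h3 := h1.sub (h2 _ hpt).tendsto
      simpa [tensorL, Function.comp_def] using h3
    have hev := hO'.and (hlim.eventually (Metric.closedBall_mem_nhds 0 hε))
    rw [eventually_nhdsWithin_iff] at hev
    filter_upwards [hev] with p hp hpS
    obtain ⟨h1, h2⟩ := hp hpS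
    exact ⟨h1, by simpa using h2⟩
  obtain ⟨δ, hδ, hball⟩ := Metric.eventually_nhds_iff_ball.1 key
  -- Halving passes from the open ball to the non-strict condition on `‖A‖`.
  refine ⟨δ / 2, by positivity, fun x hx A hA => ?_⟩
  obtain ⟨h1, h2⟩ := hball A (by rw [mem_ball_zero_iff]; linarith) x hx hx
  exact ⟨(hd1 x hx _ h1).differentiableAt (hO.mem_nhds h1),
    (hd2 x hx _ h1).differentiableAt (hO.mem_nhds h1), h2⟩

/-- Two mean value inequalities: the bound on `W_FF - L` over a ball controls the first order error
of `W_F`, and integrating that along the segment from `0` to `A` controls the remainder. -/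
lemma IsLagrangian.exists_forall_abs_remainder_le (hΩ : IsCompact (closure Ω))
    (hW : IsLagrangian Ω W G) (hG : ContinuousOn G (closure Ω)) {ε : ℝ} (hε : 0 < ε) :
    ∃ δ > 0, ∀ x ∈ closure Ω, ∀ A : Mat m d, ‖A‖ ≤ δ → |remainder W G x A| ≤ ε * ‖A‖ ^ 2 := by
  obtain ⟨δ, hδ, hH⟩ := hW.exists_forall_norm_hessF_sub_le hΩ hG hε
  refine ⟨δ, hδ, fun x hx A hA => ?_⟩
  have hgrad : ∀ B : Mat m d, ‖B‖ ≤ δ →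
      ‖gradF W x (G x + B) - gradF W x (G x) - tensorL W G x B‖ ≤ ε * ‖B‖ := by
    intro B hB
    have := Convex.norm_image_sub_le_of_norm_hasFDerivWithin_le'
      (f := fun B => gradF W x (G x + B)) (f' := fun B => hessF W x (G x + B))
      (φ := tensorL W G x) (s := Metric.closedBall (0 : Mat m d) δ) (x := 0) (y := B) (C := ε)
      (fun B hB => ?_) (fun B hB => (hH x hx B (by simpa using hB)).2.2)
      (convex_closedBall _ _) (by simpa using hδ.le) (by simpa using hB)
    · simpa using this
    · have h := (hH x hx B (by simpa using hB)).2.1.hasFDerivAt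
      exact ((hasFDerivAt_comp_add_left (G x)).2 h).hasFDerivWithinAt
  have hnorm : ∀ t ∈ Set.Icc (0 : ℝ) 1, ‖t • A‖ ≤ ‖A‖ := fun t ht => by
    rw [norm_smul, Real.norm_of_nonneg ht.1]
    exact mul_le_of_le_one_left (norm_nonneg _) ht.2
  -- On the ray through `A` the quadratic term is `½ t² (L A, A)`, so its derivative is `(L (t A),
  -- A)` without appeal to symmetry of `L`.
  have hderiv : ∀ t ∈ Set.Icc (0 : ℝ) 1, HasDerivWithinAt (fun t : ℝ => remainder W G x (t • A))
      (inner ℝ (gradF W x (G x + t • A) - gradF W x (G x) - tensorL W G x (t • A)) A)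
      (Set.Icc 0 1) t := by
    intro t ht
    have hW' : HasFDerivAt (W x) (InnerProductSpace.toDual ℝ (Mat m d)
        (gradF W x (G x + t • A))) (G x + t • A) :=
      ((hH x hx (t • A) ((hnorm t ht).trans hA)).1.hasGradientAt).hasFDerivAt
    have hline : HasDerivAt (fun t : ℝ => G x + t • A) A t := by
      simpa using ((hasDerivAt_id t).smul_const A).const_add (G x)
    have h1 := hW'.comp_hasDerivAt t hline
    have h2 : HasDerivAt (fun t : ℝ => t * inner ℝ (gradF W x (G x)) A)
        (inner ℝ (gradF W x (G x)) A) t := by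
      simpa using (hasDerivAt_id t).mul_const (inner ℝ (gradF W x (G x)) A)
    have h3 : HasDerivAt (fun t : ℝ => 1 / 2 * (t ^ 2 * inner ℝ (tensorL W G x A) A))
        (t * inner ℝ (tensorL W G x A) A) t := by
      refine (((hasDerivAt_pow 2 t).mul_const
        (inner ℝ (tensorL W G x A) A)).const_mul (1 / 2)).congr_deriv ?_
      norm_num
      ring
    have h4 := ((h1.sub_const (W x (G x))).sub h2).sub h3
    have h5 : HasDerivAt (fun t : ℝ => remainder W G x (t • A))
        (inner ℝ (gradF W x (G x + t • A) - gradF W x (G x) - tensorL W G x (t • A)) A) t := by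
      convert! h4 using 1
      · funext s
        simp only [remainder, Wcirc, map_smul, inner_smul_left, inner_smul_right, conj_trivial,
          Function.comp_apply, Pi.sub_apply]
        ring
      · simp [inner_sub_left, inner_smul_left]
    exact h5.hasDerivWithinAt
  have := norm_image_sub_le_of_norm_deriv_le_segment_01' hderiv (C := ε * ‖A‖ ^ 2) fun t ht => by
    have ht' : t ∈ Set.Icc (0 : ℝ) 1 := ⟨ht.1, ht.2.le⟩
    calc _ ≤ ‖gradF W x (G x + t • A) - gradF W x (G x) - tensorL W G x (t • A)‖ * ‖A‖ :=
          norm_inner_le_norm _ _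
      _ ≤ ε * ‖t • A‖ * ‖A‖ := by
          gcongr
          exact hgrad _ ((hnorm t ht').trans hA)
      _ ≤ ε * ‖A‖ * ‖A‖ := by
          gcongr
          exact hnorm t ht'
      _ = ε * ‖A‖ ^ 2 := by ring
  simpa [remainder, Wcirc] using this

lemma IsLagrangian.exists_forall_norm_tensorL_le (hΩ : IsCompact (closure Ω))
    (hW : IsLagrangian Ω W G) (hG : ContinuousOn G (closure Ω)) :
    ∃ Λ : ℝ, 0 ≤ Λ ∧ ∀ x ∈ closure Ω, ‖tensorL W G x‖ ≤ Λ := by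
  obtain ⟨Λ, hΛ⟩ := hΩ.exists_bound_of_continuousOn (hW.continuousOn_tensorL hG)
  exact ⟨max Λ 0, le_max_right _ _, fun x hx => (hΛ x hx).trans (le_max_left _ _)⟩

lemma abs_inner_tensorL_le {x : EuclideanSpace ℝ (Fin d)} {Λ : ℝ}
    (h : ‖tensorL W G x‖ ≤ Λ) (A : Mat m d) : |inner ℝ (tensorL W G x A) A| ≤ Λ * ‖A‖ ^ 2 := by
  calc |inner ℝ (tensorL W G x A) A| ≤ ‖tensorL W G x A‖ * ‖A‖ := abs_real_inner_le_norm _ _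
    _ ≤ Λ * ‖A‖ * ‖A‖ := by
        gcongr
        exact (tensorL W G x).le_of_opNorm_le h A
    _ = Λ * ‖A‖ ^ 2 := by ring

/-- The quotient `U = remainder / |A|²` is bounded on bounded sets. -/
lemma IsLagrangian.exists_forall_abs_remainder_le_of_norm_le (hΩ : IsCompact (closure Ω))
    (hW : IsLagrangian Ω W G) (hG : ContinuousOn G (closure Ω)) (C : ℝ) :
    ∃ M : ℝ, 0 ≤ M ∧ ∀ x ∈ closure Ω, ∀ A : Mat m d, ‖A‖ ≤ C →
      |remainder W G x A| ≤ M * ‖A‖ ^ 2 := by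
  obtain ⟨δ, hδ, hr⟩ := hW.exists_forall_abs_remainder_le hΩ hG one_pos
  obtain ⟨Λ, hΛ0, hΛ⟩ := hW.exists_forall_norm_tensorL_le hΩ hG
  obtain ⟨M, hM⟩ := (hΩ.prod (isCompact_closedBall (0 : Mat m d) C)).exists_bound_of_continuousOn
    ((hW.continuousOn_Wcirc hG).mono (Set.prod_mono le_rfl (Set.subset_univ _)))
  -- The `1` is the Taylor bound for `‖A‖ ≤ δ`. Beyond `δ`, `|M| ≤ (|M| / δ²) ‖A‖²` handles `W°`,
  -- and `Λ` dominates the quadratic term.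
  refine ⟨1 + (|M| / δ ^ 2 + Λ), by positivity, fun x hx A hA => ?_⟩
  rcases le_or_gt ‖A‖ δ with hAδ | hAδ
  · refine (hr x hx A hAδ).trans (mul_le_mul_of_nonneg_right ?_ (by positivity))
    exact le_add_of_nonneg_right (by positivity)
  · have h1 : |Wcirc W G x A| ≤ |M| / δ ^ 2 * ‖A‖ ^ 2 := by
      calc |Wcirc W G x A| ≤ |M| := (hM (x, A) ⟨hx, by simpa using hA⟩).trans (le_abs_self M)
        _ = |M| / δ ^ 2 * δ ^ 2 := by field_simp
        _ ≤ |M| / δ ^ 2 * ‖A‖ ^ 2 := by gcongr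
    have h2 := abs_inner_tensorL_le (hΛ x hx) A
    rw [abs_le] at h1 h2 ⊢
    unfold remainder
    have h3 : 0 ≤ Λ * ‖A‖ ^ 2 := by positivity
    have h4 : 0 ≤ ‖A‖ ^ 2 := by positivity
    constructor <;> nlinarith [h1.1, h1.2, h2.1, h2.2]

/-- `W°` is continuous only over the closure of `Ω`; its extension by zero is jointly Borel and
agrees with it on `Ω`. -/
lemma IsLagrangian.aestronglyMeasurable_Wcirc (hΩ : MeasurableSet Ω) (hW : IsLagrangian Ω W G)
    (hG : ContinuousOn G (closure Ω)) {f : EuclideanSpace ℝ (Fin d) → Mat m d}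
    (hf : AEStronglyMeasurable f (volume.restrict Ω)) :
    AEStronglyMeasurable (fun x => Wcirc W G x (f x)) (volume.restrict Ω) := by
  classical
  have hm : Measurable ((closure Ω ×ˢ (Set.univ : Set (Mat m d))).piecewise
      (fun p : EuclideanSpace ℝ (Fin d) × Mat m d => Wcirc W G p.1 p.2) 0) :=
    (hW.continuousOn_Wcirc hG).measurable_piecewise continuousOn_const
      (isClosed_closure.measurableSet.prod MeasurableSet.univ)
  refine (hm.comp_aemeasurable (aemeasurable_id.prodMk hf.aemeasurable)).aestronglyMeasurable.congr
    ?_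
  filter_upwards [ae_restrict_mem hΩ] with x hx
  exact Set.piecewise_eq_of_mem _ _ _ ⟨subset_closure hx, trivial⟩

end Taylor

/-! ### Quadratic forms in coordinates -/

section Quadratic

variable {ι : Type*} [Fintype ι] [DecidableEq ι]

/-- Separates the `x`-dependence of `(L(x) A, A)` from its dependence on `A`, as testing against a
Young measure requires. -/
lemma inner_apply_self_eq_sum (T : EuclideanSpace ℝ ι →L[ℝ] EuclideanSpace ℝ ι)
    (A : EuclideanSpace ℝ ι) :
    inner ℝ (T A) A = ∑ p, ∑ q, T (EuclideanSpace.single p 1) q * (A p * A q) := by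
  have hA : A = ∑ p, A p • EuclideanSpace.single p (1 : ℝ) := by
    simpa using ((EuclideanSpace.basisFun ι ℝ).sum_repr A).symm
  have hT : ∀ q, T A q = ∑ p, A p * T (EuclideanSpace.single p 1) q := fun q => by
    conv_lhs => rw [hA, map_sum]
    simp
  simp only [PiLp.inner_apply, hT, RCLike.inner_apply, conj_trivial, Finset.mul_sum]
  rw [Finset.sum_comm]
  refine Finset.sum_congr rfl fun p _ => Finset.sum_congr rfl fun q _ => ?_
  ring

omit [DecidableEq ι] in
lemma abs_apply_mul_apply_le (p q : ι) (A : EuclideanSpace ℝ ι) : |A p * A q| ≤ ‖A‖ ^ 2 := by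
  rw [abs_mul, sq]
  exact mul_le_mul (PiLp.norm_apply_le A p) (PiLp.norm_apply_le A q) (abs_nonneg _)
    (norm_nonneg _)

end Quadratic

/-! ### Vanishing of the remainder -/

section Limit

variable {d m : ℕ} {Ω : Set (EuclideanSpace ℝ (Fin d))}
  {W : EuclideanSpace ℝ (Fin d) → Mat m d → ℝ} {G : EuclideanSpace ℝ (Fin d) → Mat m d}

lemma IsDecomposition.isEquiintegrableModification (hΩb : Bornology.IsBounded Ω)
    {α : ℕ → ℝ} {ψ z v : ℕ → EuclideanSpace ℝ (Fin d) → EuclideanSpace ℝ (Fin m)}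
    {Dψ Dz Dv : ℕ → EuclideanSpace ℝ (Fin d) → Mat m d}
    {R : ℕ → Set (EuclideanSpace ℝ (Fin d))}
    (hdec : IsDecomposition Ω α ψ z v Dψ Dz Dv R) (hψ2 : BoundedW12 Ω ψ Dψ) :
    IsEquiintegrableModification (volume.restrict Ω) Dz Dψ := by
  have : IsFiniteMeasure (volume.restrict Ω) := isFiniteMeasure_restrict.2 hΩb.measure_lt_top.ne
  obtain ⟨C, hC⟩ := hψ2
  refine ⟨fun n => (hdec.mem_z n).memLp_grad.mono_exponent le_top,
    fun n => (hC n).1.memLp_grad.1, ⟨C, fun n => (hC n).2.2⟩, hdec.equiintegrable, ?_⟩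
  refine tendsto_of_tendsto_of_tendsto_of_le_of_le tendsto_const_nhds hdec.measure_R
    (fun _ => zero_le) fun n => ?_
  calc volume.restrict Ω {x | Dz n x ≠ Dψ n x} ≤ volume.restrict Ω (R n) := by
        refine measure_mono_ae ?_
        filter_upwards [hdec.eq_off_R n] with x hx hne
        by_contra hxR
        exact hne (hx hxR).2
    _ ≤ volume (R n) := Measure.restrict_apply_le _ _

/-- The remainder contributes nothing to the limit. -/
lemma IsLagrangian.tendsto_integral_mul_remainder (hΩ : MeasurableSet Ω)
    (hΩb : Bornology.IsBounded Ω) (hW : IsLagrangian Ω W G) (hG : ContinuousOn G (closure Ω))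
    {α : ℕ → ℝ} (hα : ∀ n, 0 < α n) (hα0 : Tendsto α atTop (𝓝 0))
    {f g : ℕ → EuclideanSpace ℝ (Fin d) → Mat m d}
    (H : IsEquiintegrableModification (volume.restrict Ω) f g)
    (hb : BoundedLinf Ω fun n x => α n • f n x)
    {φ : EuclideanSpace ℝ (Fin d) → ℝ} {B : ℝ} (hB : ∀ᵐ x ∂(volume.restrict Ω), ‖φ x‖ ≤ B) :
    Tendsto (fun n => ∫ x in Ω, φ x * (remainder W G x (α n • f n x) / α n ^ 2)) atTop
      (𝓝 0) := by
  have : IsFiniteMeasure (volume.restrict Ω) := isFiniteMeasure_restrict.2 hΩb.measure_lt_top.ne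
  have hK : IsCompact (closure Ω) := hΩb.isCompact_closure
  obtain ⟨C, hC⟩ := hb
  obtain ⟨M, hM0, hM⟩ := hW.exists_forall_abs_remainder_le_of_norm_le hK hG C
  obtain ⟨C₂, hC₂⟩ := H.exists_integral_sq_le
  rw [Metric.tendsto_atTop']
  intro ε hε
  set b : ℝ := |B| + 1
  have hb0 : 0 < b := by positivity
  have hBb : ∀ᵐ x ∂(volume.restrict Ω), ‖φ x‖ ≤ b := by
    filter_upwards [hB] with x hx
    exact hx.trans ((le_abs_self B).trans (le_add_of_nonneg_right zero_le_one))
  set c : ℝ := |C₂| + 1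
  have hc0 : 0 < c := by positivity
  -- After multiplication by `b`, the region `|α f| ≤ δ` contributes at most `ε / 4` because `c`
  -- bounds the integral of `|f|²`; the tail contributes at most `ε / 4` as well. `M + 1` replaces
  -- `M`, which may be zero.
  obtain ⟨δ, hδ, hr⟩ := hW.exists_forall_abs_remainder_le hK hG
    (show 0 < ε / 4 / b / c by positivity)
  obtain ⟨k, hk⟩ := H.exists_integral_tailSq_le (show 0 < ε / 4 / b / (M + 1) by positivity)
  have hαk : ∀ᶠ n in atTop, α n * k < δ := by
    have := hα0.mul_const (k : ℝ)
    rw [zero_mul] at this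
    exact this.eventually (gt_mem_nhds hδ)
  obtain ⟨N, hN⟩ := eventually_atTop.1 ((hk k le_rfl).and (hαk.and hC₂))
  refine ⟨N, fun n hn => ?_⟩
  obtain ⟨ht, hαn, hsq⟩ := hN n hn.le
  have hαp := hα n
  have hi1 := (H.memLp n).norm.integrable_sq
  have hi2 := integrable_tailSq (H.memLp n) k
  have hle : ∀ᵐ x ∂(volume.restrict Ω), ‖remainder W G x (α n • f n x) / α n ^ 2‖
      ≤ ε / 4 / b / c * ‖f n x‖ ^ 2 + M * tailSq k (f n x) := by
    filter_upwards [hC n, ae_restrict_mem hΩ] with x hx hxΩ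
    have hxK := subset_closure hxΩ
    have hns : ‖α n • f n x‖ = α n * ‖f n x‖ := by
      rw [norm_smul, Real.norm_of_nonneg hαp.le]
    rw [norm_div, Real.norm_of_nonneg (sq_nonneg (α n)), div_le_iff₀ (by positivity),
      Real.norm_eq_abs]
    -- Small arguments use the Taylor estimate. Large ones force `‖f n x‖ > k`, since `α n * k < δ`,
    -- and are charged to the tail.
    rcases le_or_gt ‖α n • f n x‖ δ with hδx | hδx
    · have h1 := hr x hxK _ hδx
      rw [hns] at h1
      have h2 : 0 ≤ M * tailSq k (f n x) * α n ^ 2 :=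
        mul_nonneg (mul_nonneg hM0 (tailSq_nonneg _ _)) (sq_nonneg _)
      calc _ ≤ ε / 4 / b / c * (α n * ‖f n x‖) ^ 2 := h1
        _ ≤ ε / 4 / b / c * (α n * ‖f n x‖) ^ 2 + M * tailSq k (f n x) * α n ^ 2 :=
            le_add_of_nonneg_right h2
        _ = _ := by ring
    · have h1 := hM x hxK _ hx
      have hkx : (k : ℝ) < ‖f n x‖ := by
        rw [hns] at hδx
        exact lt_of_mul_lt_mul_left (hαn.trans hδx) hαp.le
      rw [hns] at h1
      rw [tailSq, if_pos hkx]
      have h2 : 0 ≤ ε / 4 / b / c * ‖f n x‖ ^ 2 * α n ^ 2 := by positivity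
      calc _ ≤ M * (α n * ‖f n x‖) ^ 2 := h1
        _ ≤ ε / 4 / b / c * ‖f n x‖ ^ 2 * α n ^ 2 + M * (α n * ‖f n x‖) ^ 2 :=
            le_add_of_nonneg_left h2
        _ = _ := by ring
  rw [dist_zero_right]
  refine (norm_integral_mul_le hBb ((hi1.const_mul _).add (hi2.const_mul _)) hle).trans_lt ?_
  simp only [Pi.add_apply]
  rw [integral_add (hi1.const_mul _) (hi2.const_mul _), integral_const_mul, integral_const_mul]
  have hsq' : ∫ x in Ω, ‖f n x‖ ^ 2 ≤ c :=
    hsq.trans ((le_abs_self C₂).trans (le_add_of_nonneg_right zero_le_one))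
  have hMt : M * ∫ x in Ω, tailSq k (f n x) ≤ (M + 1) * (ε / 4 / b / (M + 1)) :=
    mul_le_mul (by linarith) ht (integral_nonneg fun x => tailSq_nonneg _ _) (by positivity)
  calc _ ≤ b * (ε / 4 / b / c * c + (M + 1) * (ε / 4 / b / (M + 1))) := by gcongr
    _ = ε / 2 := by field_simp; norm_num
    _ < ε := half_lt_self hε

lemma IsLagrangian.integrableOn_remainder (hΩ : MeasurableSet Ω) (hΩb : Bornology.IsBounded Ω)
    (hW : IsLagrangian Ω W G) (hG : ContinuousOn G (closure Ω))
    {f : EuclideanSpace ℝ (Fin d) → Mat m d} (hf : MemLp f 2 (volume.restrict Ω)) {C : ℝ}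
    (hC : ∀ᵐ x ∂(volume.restrict Ω), ‖f x‖ ≤ C)
    (hL : AEStronglyMeasurable (fun x => inner ℝ (tensorL W G x (f x)) (f x))
      (volume.restrict Ω)) :
    IntegrableOn (fun x => remainder W G x (f x)) Ω := by
  obtain ⟨M, hM0, hM⟩ := hW.exists_forall_abs_remainder_le_of_norm_le hΩb.isCompact_closure hG C
  refine (hf.norm.integrable_sq.const_mul M).mono'
    ((hW.aestronglyMeasurable_Wcirc hΩ hG hf.1).sub (hL.const_mul _)) ?_
  filter_upwards [hC, ae_restrict_mem hΩ] with x hx hxΩ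
  exact hM x (subset_closure hxΩ) _ hx

lemma exists_ae_norm_le_of_memLp_top {X : Type*} [MeasurableSpace X] {μ : Measure X} {g : X → ℝ}
    (hg : MemLp g ⊤ μ) : ∃ B : ℝ, ∀ᵐ x ∂μ, ‖g x‖ ≤ B := by
  refine ⟨(eLpNorm g ⊤ μ).toReal, ?_⟩
  filter_upwards [enorm_ae_le_eLpNormEssSup g μ] with x hx
  rw [← toReal_enorm]
  exact ENNReal.toReal_mono hg.2.ne (by rwa [eLpNorm_exponent_top])

end Limit

end VarLimit

/-! ### The weak limit of the rescaled energies -/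

open VarLimit in
theorem lemma7p2 {d m : ℕ}
    (Ω : Set (EuclideanSpace ℝ (Fin d))) (hΩ : IsOpen Ω) (hΩb : Bornology.IsBounded Ω)
    -- the reference map `y`, the extension `G` of its gradient, and the Lagrangian `W`
    (y : EuclideanSpace ℝ (Fin d) → EuclideanSpace ℝ (Fin m))
    (G : EuclideanSpace ℝ (Fin d) → VarLimit.Mat m d)
    (hy : VarLimit.IsC1Closure Ω y G)
    (W : EuclideanSpace ℝ (Fin d) → VarLimit.Mat m d → ℝ)
    (hW : VarLimit.IsLagrangian Ω W G)
    -- the sizes `α n` and the shapes `ψ n` of the variation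
    (α : ℕ → ℝ) (hα : ∀ n, 0 < α n)
    (ψ : ℕ → EuclideanSpace ℝ (Fin d) → EuclideanSpace ℝ (Fin m))
    (Dψ : ℕ → EuclideanSpace ℝ (Fin d) → VarLimit.Mat m d)
    (hψ : ∀ n, VarLimit.MemW1p Ω ∞ (ψ n) (Dψ n))
    (hψ2 : VarLimit.BoundedW12 Ω ψ Dψ)
    (hαψ : VarLimit.BoundedLinf Ω (fun n x => α n • Dψ n x))
    -- the decomposition of `ψ n`
    (z v : ℕ → EuclideanSpace ℝ (Fin d) → EuclideanSpace ℝ (Fin m))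
    (Dz Dv : ℕ → EuclideanSpace ℝ (Fin d) → VarLimit.Mat m d)
    (R : ℕ → Set (EuclideanSpace ℝ (Fin d)))
    (hdec : VarLimit.IsDecomposition Ω α ψ z v Dψ Dz Dv R)
    -- the Young measure generated by `∇ψ n`
    (ν : EuclideanSpace ℝ (Fin d) → Measure (VarLimit.Mat m d))
    (hν : VarLimit.GeneratesYoung Ω Dψ ν)
    (hα0 : Tendsto α atTop (𝓝 0)) :
    (∀ᵐ x ∂(volume.restrict Ω), Integrable (fun A : VarLimit.Mat m d => ‖A‖ ^ 2) (ν x)) ∧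
    ∃ σ : ℕ → ℕ, StrictMono σ ∧
      VarLimit.TendstoWeakL1 Ω
        (fun n x => VarLimit.scaledF W G x (α (σ n)) (Dz (σ n) x))
        (fun x => VarLimit.coefU W G x 0 * VarLimit.secondMoment ν x
          + 1 / 2 * ∫ A, inner ℝ (VarLimit.tensorL W G x A) A ∂(ν x)) := by
  have : IsFiniteMeasure (volume.restrict Ω) := isFiniteMeasure_restrict.2 hΩb.measure_lt_top.ne
  have hG := hy.continuousOn_grad
  have hK : IsCompact (closure Ω) := hΩb.isCompact_closure
  have hΩm := hΩ.measurableSet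
  have H := hdec.isEquiintegrableModification hΩb hψ2
  obtain ⟨C, hC⟩ := H.bounded
  -- The constant `1` is an admissible weight since `Ω` has finite measure.
  have h2 := lintegral_lintegral_enorm_sq_lt_top hν.aemeasurable hν.isProbability
    (fun h => by simpa using hν.limit h (fun _ => 1) (integrable_const _))
    H.aestronglyMeasurable hC
  have hint := ae_integrable_norm_sq hν.aemeasurable h2
  -- The whole sequence converges: the limit is already determined by `ν`.
  refine ⟨hint, id, strictMono_id, ?_⟩
  obtain ⟨Λ, -, hΛ⟩ := hW.exists_forall_norm_tensorL_le hK hG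
  set L : Fin m × Fin d → Fin m × Fin d → EuclideanSpace ℝ (Fin d) → ℝ :=
    fun p q x => tensorL W G x (EuclideanSpace.single p 1) q
  have hLm : ∀ p q, AEStronglyMeasurable (L p q) (volume.restrict Ω) := fun p q => by
    refine ContinuousOn.aestronglyMeasurable ?_ hΩm
    have h1 : ContinuousOn (fun x => tensorL W G x (EuclideanSpace.single p 1)) Ω :=
      ((hW.continuousOn_tensorL hG).mono subset_closure).clm_apply continuousOn_const
    exact (EuclideanSpace.proj (𝕜 := ℝ) q).continuous.comp_continuousOn h1
  have hLb : ∀ p q, ∀ᵐ x ∂(volume.restrict Ω), ‖L p q x‖ ≤ Λ := fun p q => by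
    filter_upwards [ae_restrict_mem hΩm] with x hx
    refine (PiLp.norm_apply_le _ q).trans ?_
    simpa using (tensorL W G x).le_of_opNorm_le (hΛ x (subset_closure hx))
      (EuclideanSpace.single p 1)
  have hcont : ∀ p q : Fin m × Fin d, Continuous fun A : Mat m d => A p * A q := fun p q => by
    fun_prop
  have hquad : ∀ n, IntegrableOn (fun x => inner ℝ (tensorL W G x (Dz n x)) (Dz n x)) Ω := by
    intro n
    simp only [inner_apply_self_eq_sum]
    refine integrable_finsetSum _ fun p _ => integrable_finsetSum _ fun q _ => ?_
    exact (integrable_comp_of_le_sq (H.memLp n) (hcont p q)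
      (abs_apply_mul_apply_le p q)).bdd_mul (hLm p q) (hLb p q)
  have hrem : ∀ n, IntegrableOn (fun x => remainder W G x (α n • Dz n x) / α n ^ 2) Ω := by
    intro n
    obtain ⟨C, hC⟩ := hdec.bounded_z
    refine (hW.integrableOn_remainder hΩm hΩb hG ((H.memLp n).const_smul (α n)) (hC n) ?_).div_const
      _
    simpa [inner_smul_left, inner_smul_right] using
      ((hquad n).1.const_mul (α n)).const_mul (α n)
  have hmom : ∀ p q, IntegrableOn (fun x => L p q x * ∫ A, A p * A q ∂(ν x)) Ω := fun p q =>
    (integrable_integral_of_le_sq hν.aemeasurable h2 (hcont p q).measurable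
      (abs_apply_mul_apply_le p q)).bdd_mul (hLm p q) (hLb p q)
  have hlimeq : ∀ᵐ x ∂(volume.restrict Ω), coefU W G x 0 * secondMoment ν x
      + 1 / 2 * ∫ A, inner ℝ (tensorL W G x A) A ∂(ν x)
      = 1 / 2 * ∑ p, ∑ q, L p q x * ∫ A, A p * A q ∂(ν x) := by
    filter_upwards [hint] with x hx
    have hi : ∀ p q : Fin m × Fin d, Integrable (fun A : Mat m d => L p q x * (A p * A q)) (ν x) :=
      fun p q => (hx.mono' (hcont p q).measurable.aestronglyMeasurable
        (ae_of_all _ (abs_apply_mul_apply_le p q))).const_mul _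
    -- `U(x, 0) = 0` by definition, so the second moment term drops out.
    simp only [coefU, if_true, zero_mul, zero_add, inner_apply_self_eq_sum]
    rw [integral_finsetSum _ fun p _ => integrable_finsetSum _ fun q _ => hi p q]
    congr 1
    refine Finset.sum_congr rfl fun p _ => ?_
    rw [integral_finsetSum _ fun q _ => hi p q]
    simp only [integral_const_mul, L]
  refine ⟨fun n => ?_, ?_, fun g hg => ?_⟩
  · simp only [id, scaledF_eq _ (hα n)]
    exact (hrem n).add ((hquad n).const_mul _)
  · refine Integrable.congr ?_ (hlimeq.mono fun x hx => hx.symm)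
    exact (integrable_finsetSum _ fun p _ => integrable_finsetSum _ fun q _ =>
      hmom p q).const_mul _
  · obtain ⟨B, hB⟩ := exists_ae_norm_le_of_memLp_top hg
    have hgL : ∀ p q, ∀ᵐ x ∂(volume.restrict Ω), ‖g x * L p q x‖ ≤ B * Λ := fun p q => by
      filter_upwards [hB, hLb p q] with x h1 h3
      rw [norm_mul]
      exact mul_le_mul h1 h3 (norm_nonneg _) ((norm_nonneg _).trans h1)
    -- The coefficient `L p q` joins `g` in a bounded weight, leaving the `x`-independent integrand
    -- `A p * A q`.
    have hlim : ∀ p q, Tendsto (fun n => ∫ x in Ω, g x * L p q x * (Dz n x p * Dz n x q)) atTop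
        (𝓝 (∫ x in Ω, g x * L p q x * ∫ A, A p * A q ∂(ν x))) := fun p q =>
      H.tendsto_integral_mul_comp hν.aemeasurable hν.isProbability hν.limit h2
        (hg.1.mul (hLm p q)) (hgL p q) (hcont p q) (abs_apply_mul_apply_le p q)
    have hr := hW.tendsto_integral_mul_remainder hΩm hΩb hG hα hα0 H hdec.bounded_z hB
    have hsum := hr.add ((tendsto_finsetSum Finset.univ fun p _ =>
      tendsto_finsetSum Finset.univ fun q _ => hlim p q).const_mul (1 / 2))
    convert! hsum using 2 with n
    · have hi : ∀ p q, Integrable (fun x => g x * L p q x * (Dz n x p * Dz n x q))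
          (volume.restrict Ω) := fun p q =>
        (integrable_comp_of_le_sq (H.memLp n) (hcont p q)
          (abs_apply_mul_apply_le p q)).bdd_mul (hg.1.mul (hLm p q)) (hgL p q)
      simp only [← integral_finsetSum _ fun q _ => hi _ q]
      rw [← integral_finsetSum _ fun p _ => integrable_finsetSum _ fun q _ => hi p q,
        ← integral_const_mul, ← integral_add ((hrem n).bdd_mul hg.1 hB)
        ((integrable_finsetSum _ fun p _ => integrable_finsetSum _ fun q _ => hi p q).const_mul
          _)]
      refine integral_congr_ae (ae_of_all _ fun x => ?_)
      simp only [id, scaledF_eq _ (hα n), inner_apply_self_eq_sum, mul_assoc, ← Finset.mul_sum, L]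
      ring
    · have hi : ∀ p q, Integrable (fun x => g x * L p q x * ∫ A, A p * A q ∂(ν x))
          (volume.restrict Ω) := fun p q => by
        simpa only [mul_assoc] using (hmom p q).bdd_mul hg.1 hB
      simp only [← integral_finsetSum _ fun q _ => hi _ q]
      rw [← integral_finsetSum _ fun p _ => integrable_finsetSum _ fun q _ => hi p q,
        ← integral_const_mul, zero_add]
      refine integral_congr_ae ?_
      filter_upwards [hlimeq] with x hx
      simp only [hx, mul_assoc, ← Finset.mul_sum]
      ring
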